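/- Let $\mathbf O$ be the octonions, with conjugation $x\mapsto\overline x$ and Euclidean inner product $(x|y)$. For $\xi_i\in\mathbb R$, $x_i\in\mathbf O$ put $$h^1(\xi_1,\xi_2,\xi_3;x_1,x_2,x_3)=\begin{pmatrix}\xi_1&\sqrt{-1}\,x_3&\sqrt{-1}\,\overline{x_2}\\ \sqrt{-1}\,\overline{x_3}&\xi_2&x_1\\ \sqrt{-1}\,x_2&\overline{x_1}&\xi_3\end{pmatrix},$$ and let $\mathcal J^1$ be the real vector space of all these matrices, with Jordan product $X\circ Y=\frac12(XY+YX)$, trace $\mathrm{tr}(X)=\xi_1+\xi_2+\xi_3$, inner product $(X|Y)=\mathrm{tr}(X\circ Y)$, and cross product $X\times Y=\frac12\bigl(2X\circ Y-\mathrm{tr}(X)Y-\mathrm{tr}(Y)X+(\mathrm{tr}(X)\mathrm{tr}(Y)-(X|Y))E\bigr)$, where $E$ is the unit matrix. Let $E_1=h^1(1,0,0;0,0,0)$. Let $\mathrm F_{4(-20)}$ be the group of linear automorphisms $g$ of $\mathcal J^1$ with $g(X\circ Y)=gX\circ gY$; its Lie algebra $\mathfrak f_{4(-20)}$ consists of the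 derivations of $\circ$. Let $\sigma\in\mathrm F_{4(-20)}$ be the map $h^1(\xi_1,\xi_2,\xi_3;x_1,x_2,x_3)\mapsto h^1(\xi_1,\xi_2,\xi_3;x_1,-x_2,-x_3)$, and let $\tilde A^1_3(1)\in\mathfrak f_{4(-20)}$ be the derivation $$h^1(\xi_1,\xi_2,\xi_3;x_1,x_2,x_3)\mapsto h^1\bigl(-2(1|x_3),\,2(1|x_3),\,0;\ \overline{x_2},\,\overline{x_1},\,-(\xi_1-\xi_2)1\bigr).$$ Put $\mathfrak g_{c\alpha}=\{D\in\mathfrak f_{4(-20)}\mid[\tilde A^1_3(1),D]=cD\}$, $\mathfrak n^-=\mathfrak g_{-\alpha}+\mathfrak g_{-2\alpha}$, and let $N^-=\exp\mathfrak n^-$, the subgroup of $\mathrm F_{4(-20)}$ with Lie algebra $\mathfrak n^-$. Let $\mathcal N_1^-=\{X\in\mathcal J^1\mid X\times X=0,\ \mathrm{tr}(X)=0,\ (E_1|X)<0\}$ and $\mathcal F=\mathcal N_1^- /\!\sim$, where $X\sim Y$ if and only if $Y=rX$ for some $r>0$; write $[X]$ for the class of $X$, and $g[X]=[gX]$. Let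 $P^-=h^1(-1,1,0;0,0,1)$, so that $P^-,\sigma P^-\in\mathcal N_1^-$. **Theorem.** $\mathcal F$ decomposes into the following two $N^-$-orbits: $$\mathcal F=N^-\cdot[P^-]\ \sqcup\ N^-\cdot[\sigma P^-],$$ where $$N^-\cdot[P^-]=\{[X]\in\mathcal F\mid(X|\sigma P^-)>0\}=\{[X]\in\mathcal F\mid(X|\sigma P^-)\neq0\},$$ $$N^-\cdot[\sigma P^-]=\{[X]\in\mathcal F\mid(X|\sigma P^-)=0\}=\{[\sigma P^-]\}.$$ -/

import Mathlib

open scoped Quaternion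

set_option linter.unusedSimpArgs false

noncomputable section

/-! ### The octonions -/

/-- The octonions `𝐎`, as the Cayley-Dickson double of Hamilton's quaternions. -/
def Octonion : Type := ℍ[ℝ] × ℍ[ℝ]

namespace Octonion

instance : AddCommGroup Octonion := inferInstanceAs (AddCommGroup (ℍ[ℝ] × ℍ[ℝ]))
instance : Module ℝ Octonion := inferInstanceAs (Module ℝ (ℍ[ℝ] × ℍ[ℝ]))
instance : TopologicalSpace Octonion := inferInstanceAs (TopologicalSpace (ℍ[ℝ] × ℍ[ℝ]))
instance : IsTopologicalAddGroup Octonion :=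
  inferInstanceAs (IsTopologicalAddGroup (ℍ[ℝ] × ℍ[ℝ]))
instance : ContinuousSMul ℝ Octonion := inferInstanceAs (ContinuousSMul ℝ (ℍ[ℝ] × ℍ[ℝ]))
instance : T2Space Octonion := inferInstanceAs (T2Space (ℍ[ℝ] × ℍ[ℝ]))

/-- The octonion `a + b ℓ` with quaternions `a`, `b`. -/
def mk (a b : ℍ[ℝ]) : Octonion := (a, b)

/-- The unit octonion. -/
instance : One Octonion := ⟨mk 1 0⟩

/-- The Cayley-Dickson product `(a, b)(c, d) = (ac - d̄b, da + bc̄)`. -/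
instance : Mul Octonion :=
  ⟨fun x y => mk (x.1 * y.1 - star y.2 * x.2) (y.2 * x.1 + x.2 * star y.1)⟩

/-- The conjugation `x ↦ x̄`. -/
def conj (x : Octonion) : Octonion := mk (star x.1) (-x.2)

/-- The Euclidean inner product `(x|y)`. -/
def ip (x y : Octonion) : ℝ := inner ℝ x.1 y.1 + inner ℝ x.2 y.2

theorem ext {x y : Octonion} (h1 : x.1 = y.1) (h2 : x.2 = y.2) : x = y := Prod.ext h1 h2

theorem ext_iff {x y : Octonion} : x = y ↔ x.1 = y.1 ∧ x.2 = y.2 := Prod.ext_iff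

@[simp] theorem mk_fst (a b : ℍ[ℝ]) : (mk a b).1 = a := rfl
@[simp] theorem mk_snd (a b : ℍ[ℝ]) : (mk a b).2 = b := rfl
@[simp] theorem zero_fst : (0 : Octonion).1 = 0 := rfl
@[simp] theorem zero_snd : (0 : Octonion).2 = 0 := rfl
@[simp] theorem one_fst : (1 : Octonion).1 = 1 := rfl
@[simp] theorem one_snd : (1 : Octonion).2 = 0 := rfl
@[simp] theorem add_fst (x y : Octonion) : (x + y).1 = x.1 + y.1 := rfl
@[simp] theorem add_snd (x y : Octonion) : (x + y).2 = x.2 + y.2 := rfl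
@[simp] theorem neg_fst (x : Octonion) : (-x).1 = -x.1 := rfl
@[simp] theorem neg_snd (x : Octonion) : (-x).2 = -x.2 := rfl
@[simp] theorem sub_fst (x y : Octonion) : (x - y).1 = x.1 - y.1 := rfl
@[simp] theorem sub_snd (x y : Octonion) : (x - y).2 = x.2 - y.2 := rfl
@[simp] theorem smul_fst (r : ℝ) (x : Octonion) : (r • x).1 = r • x.1 := rfl
@[simp] theorem smul_snd (r : ℝ) (x : Octonion) : (r • x).2 = r • x.2 := rfl
@[simp] theorem mul_fst (x y : Octonion) : (x * y).1 = x.1 * y.1 - star y.2 * x.2 := rfl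
@[simp] theorem mul_snd (x y : Octonion) : (x * y).2 = y.2 * x.1 + x.2 * star y.1 := rfl
@[simp] theorem conj_fst (x : Octonion) : (conj x).1 = star x.1 := rfl
@[simp] theorem conj_snd (x : Octonion) : (conj x).2 = -x.2 := rfl

instance : NonUnitalNonAssocRing Octonion where
  left_distrib x y z := by apply ext <;> simp [mul_add, add_mul] <;> abel
  right_distrib x y z := by apply ext <;> simp [mul_add, add_mul] <;> abel
  zero_mul x := by apply ext <;> simp
  mul_zero x := by apply ext <;> simp

instance : IsScalarTower ℝ Octonion Octonion :=
  ⟨fun r x y => by apply ext <;> simp [smul_sub]⟩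

instance : SMulCommClass ℝ Octonion Octonion :=
  ⟨fun r x y => by apply ext <;> simp [smul_sub]⟩

protected theorem one_mul (x : Octonion) : 1 * x = x := by apply ext <;> simp
protected theorem mul_one (x : Octonion) : x * 1 = x := by apply ext <;> simp
theorem conj_one : conj 1 = 1 := by apply ext <;> simp
theorem conj_zero : conj 0 = 0 := by apply ext <;> simp
theorem conj_conj (x : Octonion) : conj (conj x) = x := by apply ext <;> simp
theorem conj_add (x y : Octonion) : conj (x + y) = conj x + conj y := by
  apply ext <;> simp [add_comm]
theorem conj_neg (x : Octonion) : conj (-x) = -conj x := by apply ext <;> simp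
theorem conj_smul (r : ℝ) (x : Octonion) : conj (r • x) = r • conj x := by apply ext <;> simp
theorem conj_mul (x y : Octonion) : conj (x * y) = conj y * conj x := by
  apply ext <;> simp [sub_eq_add_neg, add_comm]
theorem ip_comm (x y : Octonion) : ip x y = ip y x := by simp [ip, real_inner_comm]
theorem ip_zero (x : Octonion) : ip x 0 = 0 := by simp [ip]
theorem zero_ip (x : Octonion) : ip 0 x = 0 := by simp [ip]
theorem ip_one_one : ip 1 1 = 1 := by simp [ip, Quaternion.inner_def]
theorem ip_add_left (x y z : Octonion) : ip (x + y) z = ip x z + ip y z := by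
  simp [ip, inner_add_left]; ring
theorem ip_add_right (x y z : Octonion) : ip x (y + z) = ip x y + ip x z := by
  simp [ip, inner_add_right]; ring
theorem ip_smul_left (r : ℝ) (x y : Octonion) : ip (r • x) y = r * ip x y := by
  simp [ip, real_inner_smul_left]; ring
theorem ip_smul_right (r : ℝ) (x y : Octonion) : ip x (r • y) = r * ip x y := by
  simp [ip, real_inner_smul_right]; ring
theorem ip_neg_left (x y : Octonion) : ip (-x) y = -ip x y := by
  simp [ip]; ring
theorem ip_neg_right (x y : Octonion) : ip x (-y) = -ip x y := by
  simp [ip]; ring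
theorem ip_conj_one (x : Octonion) : ip (conj x) 1 = ip 1 x := by
  simp [ip, Quaternion.inner_def]
theorem ip_one_conj (x : Octonion) : ip 1 (conj x) = ip 1 x := by
  simp [ip, Quaternion.inner_def]
theorem ip_one_mul (x y : Octonion) : ip 1 (x * y) = ip (conj x) y := by
  simp [ip, Quaternion.inner_def]; ring
theorem add_conj (x : Octonion) : x + conj x = (2 * ip 1 x) • (1 : Octonion) := by
  apply ext <;> simp [ip, Quaternion.ext_iff, Quaternion.inner_def]; ring
theorem mul_conj_add (x y : Octonion) : x * conj y + y * conj x = (2 * ip x y) • (1 : Octonion) := by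
  apply ext
  · simp [ip, Quaternion.ext_iff, Quaternion.inner_def]
    constructorm* _ ∧ _ <;> ring
  · simp
theorem conj_mul_add (x y : Octonion) : conj x * y + conj y * x = (2 * ip x y) • (1 : Octonion) := by
  apply ext
  · simp [ip, Quaternion.ext_iff, Quaternion.inner_def]
    constructorm* _ ∧ _ <;> ring
  · simp

end Octonion

namespace F4

open Octonion

/-! ### The exceptional Jordan algebra `𝒥¹` -/

/-- The underlying real vector space of `𝒥¹`. The pair `(ξ, x)` stands for the matrix
`h¹(ξ₁, ξ₂, ξ₃; x₁, x₂, x₃)`, see `J.toMatrix`; the indices `1, 2, 3` are `0, 1, 2` here. -/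
abbrev J : Type := (Fin 3 → ℝ) × (Fin 3 → Octonion)

/-- `h¹(ξ₁, ξ₂, ξ₃; x₁, x₂, x₃)`. -/
def h1 (a b c : ℝ) (x y z : Octonion) : J := (![a, b, c], ![x, y, z])

/-- The Jordan product `X ∘ Y = ½ (XY + YX)` in coordinates; `J.toMatrix_jordan` checks it against
the matrix product. -/
def jordan (X Y : J) : J :=
  h1 (X.1 0 * Y.1 0 - ip (X.2 1) (Y.2 1) - ip (X.2 2) (Y.2 2))
    (X.1 1 * Y.1 1 + ip (X.2 0) (Y.2 0) - ip (X.2 2) (Y.2 2))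
    (X.1 2 * Y.1 2 + ip (X.2 0) (Y.2 0) - ip (X.2 1) (Y.2 1))
    ((1 / 2 : ℝ) • ((X.1 1 + X.1 2) • Y.2 0 + (Y.1 1 + Y.1 2) • X.2 0
      - conj (X.2 1 * Y.2 2 + Y.2 1 * X.2 2)))
    ((1 / 2 : ℝ) • ((X.1 2 + X.1 0) • Y.2 1 + (Y.1 2 + Y.1 0) • X.2 1
      + conj (X.2 2 * Y.2 0 + Y.2 2 * X.2 0)))
    ((1 / 2 : ℝ) • ((X.1 0 + X.1 1) • Y.2 2 + (Y.1 0 + Y.1 1) • X.2 2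
      + conj (X.2 0 * Y.2 1 + Y.2 0 * X.2 1)))

/-- The trace. -/
def tr (X : J) : ℝ := X.1 0 + X.1 1 + X.1 2

/-- The inner product `(X|Y) = tr (X ∘ Y)`. -/
def ipJ (X Y : J) : ℝ := tr (jordan X Y)

/-- The unit matrix `E`. -/
def E : J := h1 1 1 1 0 0 0

/-- The diagonal idempotent `E₁`. -/
def E₁ : J := h1 1 0 0 0 0 0

/-- The cross product
`X × Y = ½ (2 X ∘ Y - tr(X) Y - tr(Y) X + (tr(X) tr(Y) - (X|Y)) E)`. -/
def cross (X Y : J) : J :=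
  (1 / 2 : ℝ) • ((2 : ℝ) • jordan X Y - tr X • Y - tr Y • X + (tr X * tr Y - ipJ X Y) • E)

/-! ### The matrix model of `𝒥¹`, as a check of the coordinate formula for the product -/

/-- The complexified octonions `𝐎 ⊗ ℂ`; `(x, y)` stands for `x + √-1 y`. -/
def OctonionC : Type := Octonion × Octonion

namespace OctonionC

instance : AddCommGroup OctonionC := inferInstanceAs (AddCommGroup (Octonion × Octonion))
instance : Module ℝ OctonionC := inferInstanceAs (Module ℝ (Octonion × Octonion))
instance : Mul OctonionC :=
  ⟨fun x y => (x.1 * y.1 - x.2 * y.2, x.1 * y.2 + x.2 * y.1)⟩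

theorem ext {x y : OctonionC} (h1 : x.1 = y.1) (h2 : x.2 = y.2) : x = y := Prod.ext h1 h2
@[simp] theorem add_fst (x y : OctonionC) : (x + y).1 = x.1 + y.1 := rfl
@[simp] theorem add_snd (x y : OctonionC) : (x + y).2 = x.2 + y.2 := rfl
@[simp] theorem smul_fst (r : ℝ) (x : OctonionC) : (r • x).1 = r • x.1 := rfl
@[simp] theorem smul_snd (r : ℝ) (x : OctonionC) : (r • x).2 = r • x.2 := rfl
@[simp] theorem mul_fst (x y : OctonionC) : (x * y).1 = x.1 * y.1 - x.2 * y.2 := rfl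
@[simp] theorem mul_snd (x y : OctonionC) : (x * y).2 = x.1 * y.2 + x.2 * y.1 := rfl

/-- `x ∈ 𝐎` as an element of `𝐎 ⊗ ℂ`. -/
def re (x : Octonion) : OctonionC := (x, 0)

/-- `√-1 x` for `x ∈ 𝐎`. -/
def im (x : Octonion) : OctonionC := (0, x)

@[simp] theorem re_fst (x : Octonion) : (re x).1 = x := rfl
@[simp] theorem re_snd (x : Octonion) : (re x).2 = 0 := rfl
@[simp] theorem im_fst (x : Octonion) : (im x).1 = 0 := rfl
@[simp] theorem im_snd (x : Octonion) : (im x).2 = x := rfl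

theorem re_mul_re (x y : Octonion) : re x * re y = re (x * y) := by apply ext <;> simp
theorem re_mul_im (x y : Octonion) : re x * im y = im (x * y) := by apply ext <;> simp
theorem im_mul_re (x y : Octonion) : im x * re y = im (x * y) := by apply ext <;> simp
theorem im_mul_im (x y : Octonion) : im x * im y = re (-(x * y)) := by apply ext <;> simp
theorem re_add (x y : Octonion) : re x + re y = re (x + y) := by apply ext <;> simp
theorem im_add (x y : Octonion) : im x + im y = im (x + y) := by apply ext <;> simp
theorem re_smul (r : ℝ) (x : Octonion) : r • re x = re (r • x) := by apply ext <;> simp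
theorem im_smul (r : ℝ) (x : Octonion) : r • im x = im (r • x) := by apply ext <;> simp

end OctonionC

open OctonionC in
/-- The Hermitian-type matrix `h¹(ξ; x)` over `𝐎 ⊗ ℂ`. -/
def J.toMatrix (X : J) : Matrix (Fin 3) (Fin 3) OctonionC :=
  !![re (X.1 0 • 1), im (X.2 2), im (conj (X.2 1));
     im (conj (X.2 2)), re (X.1 1 • 1), re (X.2 0);
     im (X.2 1), re (conj (X.2 0)), re (X.1 2 • 1)]

theorem J.toMatrix_jordan (X Y : J) :
    J.toMatrix (jordan X Y) =
      (1 / 2 : ℝ) • (J.toMatrix X * J.toMatrix Y + J.toMatrix Y * J.toMatrix X) := by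
  have e (x y : Octonion) : (2⁻¹ : ℝ) • (x * conj y) + (2⁻¹ : ℝ) • (y * conj x) = ip x y • 1 := by
    rw [← smul_add, mul_conj_add, smul_smul]; norm_num [← mul_assoc]
  have e' (x y : Octonion) : (2⁻¹ : ℝ) • (conj x * y) + (2⁻¹ : ℝ) • (conj y * x) = ip x y • 1 := by
    rw [← smul_add, conj_mul_add, smul_smul]; norm_num [← mul_assoc]
  refine Matrix.ext fun i j => ?_
  fin_cases i <;> fin_cases j <;>
    simp [J.toMatrix, Matrix.mul_apply, Fin.sum_univ_three, OctonionC.re_mul_re,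
      OctonionC.re_mul_im, OctonionC.im_mul_re, OctonionC.im_mul_im, OctonionC.re_add,
      OctonionC.im_add, OctonionC.re_smul, OctonionC.im_smul] <;>
    refine congrArg _ ?_ <;>
    simp [jordan, h1, Octonion.one_mul, Octonion.mul_one, Octonion.conj_mul, conj_add, conj_smul,
      conj_neg, sub_eq_add_neg, conj_conj, smul_mul_assoc, mul_smul_comm]
  · linear_combination (norm := module) e' (X.2 1) (Y.2 1) + e (X.2 2) (Y.2 2)
  · module
  · module
  · module
  · linear_combination (norm := module) e' (X.2 2) (Y.2 2) - e (X.2 0) (Y.2 0)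
  · module
  · module
  · module
  · linear_combination (norm := module) e (X.2 1) (Y.2 1) - e' (X.2 0) (Y.2 0)

/-! ### The group `F₄₍₋₂₀₎`, its Lie algebra, and `σ` -/

/-- `F₄₍₋₂₀₎`: the linear automorphisms of `𝒥¹` that preserve the Jordan product. -/
def G : Subgroup (J ≃ₗ[ℝ] J) where
  carrier := {g | ∀ X Y, g (jordan X Y) = jordan (g X) (g Y)}
  mul_mem' := by
    intro g h hg hh X Y
    have kg : ∀ X Y, g (jordan X Y) = jordan (g X) (g Y) := hg
    have kh : ∀ X Y, h (jordan X Y) = jordan (h X) (h Y) := hh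
    simp [LinearEquiv.mul_apply, kg, kh]
  one_mem' := by intro X Y; rfl
  inv_mem' := by
    intro g hg X Y
    apply g.injective
    have kg : ∀ X Y, g (jordan X Y) = jordan (g X) (g Y) := hg
    have h : ∀ Z, g (g⁻¹ Z) = Z := fun Z => g.apply_symm_apply Z
    rw [kg, h, h, h]

theorem J_ext {X Y : J} (h0 : X.1 0 = Y.1 0) (h1 : X.1 1 = Y.1 1) (h2 : X.1 2 = Y.1 2)
    (k0 : X.2 0 = Y.2 0) (k1 : X.2 1 = Y.2 1) (k2 : X.2 2 = Y.2 2) : X = Y := by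
  refine Prod.ext (funext fun i => ?_) (funext fun i => ?_) <;> fin_cases i <;> assumption

theorem jordan_add_left (X X' Y : J) : jordan (X + X') Y = jordan X Y + jordan X' Y := by
  apply J_ext <;> simp [jordan, h1, mul_add, add_mul, smul_mul_assoc, mul_smul_comm, conj_add, conj_smul, ip_add_left, ip_add_right, ip_smul_left, ip_smul_right] <;> first | ring1 | module

theorem jordan_add_right (X Y Y' : J) : jordan X (Y + Y') = jordan X Y + jordan X Y' := by
  apply J_ext <;> simp [jordan, h1, mul_add, add_mul, smul_mul_assoc, mul_smul_comm, conj_add, conj_smul, ip_add_left, ip_add_right, ip_smul_left, ip_smul_right] <;> first | ring1 | module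

theorem jordan_smul_left (r : ℝ) (X Y : J) : jordan (r • X) Y = r • jordan X Y := by
  apply J_ext <;> simp [jordan, h1, mul_add, add_mul, smul_mul_assoc, mul_smul_comm, conj_add, conj_smul, ip_add_left, ip_add_right, ip_smul_left, ip_smul_right] <;> first | ring1 | module

theorem jordan_smul_right (r : ℝ) (X Y : J) : jordan X (r • Y) = r • jordan X Y := by
  apply J_ext <;> simp [jordan, h1, mul_add, add_mul, smul_mul_assoc, mul_smul_comm, conj_add, conj_smul, ip_add_left, ip_add_right, ip_smul_left, ip_smul_right] <;> first | ring1 | module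

/-- The Lie algebra of `F₄₍₋₂₀₎`: the derivations of `𝒥¹`. -/
def f4 : Submodule ℝ (Module.End ℝ J) where
  carrier := {D | ∀ X Y, D (jordan X Y) = jordan (D X) Y + jordan X (D Y)}
  add_mem' := by
    intro D D' h h' X Y
    have k : ∀ A B, D (jordan A B) = jordan (D A) B + jordan A (D B) := h
    have k' : ∀ A B, D' (jordan A B) = jordan (D' A) B + jordan A (D' B) := h'
    simp only [LinearMap.add_apply, k, k', jordan_add_left, jordan_add_right]
    abel
  zero_mem' := by
    intro X Y
    have h1 := jordan_smul_left 0 0 Y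
    have h2 := jordan_smul_right 0 X 0
    simp only [zero_smul] at h1 h2
    simp [h1, h2]
  smul_mem' := by
    intro r D h X Y
    have k : ∀ A B, D (jordan A B) = jordan (D A) B + jordan A (D B) := h
    simp only [LinearMap.smul_apply, k, jordan_smul_left, jordan_smul_right, smul_add]

/-- The linear map `σ = σ₁`, which changes the signs of `x₂` and `x₃`. -/
def sigmaLin : J ≃ₗ[ℝ] J :=
  LinearEquiv.ofInvolutive
    { toFun := fun X => h1 (X.1 0) (X.1 1) (X.1 2) (X.2 0) (-X.2 1) (-X.2 2)
      map_add' := fun X Y => by apply J_ext <;> simp [h1, add_comm]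
      map_smul' := fun r X => by apply J_ext <;> simp [h1] }
    (fun X => by apply J_ext <;> simp [h1])

theorem sigmaLin_apply (X : J) :
    sigmaLin X = h1 (X.1 0) (X.1 1) (X.1 2) (X.2 0) (-X.2 1) (-X.2 2) := rfl

/-- `σ` as an element of `F₄₍₋₂₀₎`. -/
def sigma : G := ⟨sigmaLin, fun X Y => by
  apply J_ext <;> simp [sigmaLin_apply, jordan, h1, conj_add, conj_neg, ip_neg_left,
    ip_neg_right]
  · module
  · module⟩

/-! ### The root spaces and `N⁻` -/

/-- The generator `Ã₃¹(1)` of the one-dimensional space `𝔞`. -/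
def A₃ : Module.End ℝ J where
  toFun X := h1 (-2 * ip 1 (X.2 2)) (2 * ip 1 (X.2 2)) 0
    (conj (X.2 1)) (conj (X.2 0)) (-(X.1 0 - X.1 1) • 1)
  map_add' X Y := by
    apply J_ext <;> simp [h1, conj_add, ip_add_right] <;> first | ring1 | module
  map_smul' r X := by
    apply J_ext <;> simp [h1, conj_smul, ip_smul_right] <;> first | ring1 | module

theorem A₃_apply (X : J) : A₃ X = h1 (-2 * ip 1 (X.2 2)) (2 * ip 1 (X.2 2)) 0
    (conj (X.2 1)) (conj (X.2 0)) (-(X.1 0 - X.1 1) • 1) := rfl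

theorem A₃_mem : A₃ ∈ f4 := by
  intro X Y
  have l (x y : Octonion) : (2 * ip 1 x) • y = x * y + conj x * y := by
    rw [← add_mul, add_conj, smul_mul_assoc, Octonion.one_mul]
  have r (x y : Octonion) : (2 * ip 1 x) • y = y * x + y * conj x := by
    rw [← mul_add, add_conj, mul_smul_comm, Octonion.mul_one]
  have c (x y : Octonion) : ip (conj x) y = ip x (conj y) := by
    simp [ip, Quaternion.inner_def]
  have s (x y : Octonion) : ip y (conj x) = ip x (conj y) := by rw [ip_comm, c]
  apply J_ext <;> simp only [A₃_apply, jordan, h1]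
  all_goals simp [conj_add, conj_smul, conj_neg, sub_eq_add_neg, Octonion.conj_mul,
    conj_conj, conj_one, Octonion.one_mul, Octonion.mul_one, smul_mul_assoc, mul_smul_comm,
    ip_add_right, ip_smul_right, ip_smul_left, ip_neg_left, ip_neg_right, ip_one_mul, add_mul, mul_add, c]
  · linear_combination -s (X.2 0) (Y.2 1) + (Y.1 0 - Y.1 1) * ip_comm 1 (X.2 2)
  · linear_combination s (X.2 0) (Y.2 1) + (Y.1 0 - Y.1 1) * ip_comm 1 (X.2 2)
  · linear_combination (norm := module)
      (-2⁻¹ : ℝ) • l (X.2 2) (Y.2 0) + (-2⁻¹ : ℝ) • l (Y.2 2) (X.2 0)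
  · linear_combination (norm := module)
      (2⁻¹ : ℝ) • r (X.2 2) (Y.2 1) + (2⁻¹ : ℝ) • r (Y.2 2) (X.2 1)
  · linear_combination (norm := module)
      (-2⁻¹ : ℝ) • mul_conj_add (X.2 0) (Y.2 0) + (-2⁻¹ : ℝ) • conj_mul_add (X.2 1) (Y.2 1)

/-- The space `𝔤_{cα} = {D | [H, D] = cα(H) D for all H ∈ 𝔞}`, where `α(Ã₃¹(1)) = 1`. -/
def rootSpace (c : ℝ) : Submodule ℝ (Module.End ℝ J) where
  carrier := {D | D ∈ f4 ∧ A₃ * D - D * A₃ = c • D}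
  add_mem' := by
    rintro D D' ⟨h, e⟩ ⟨h', e'⟩
    exact ⟨f4.add_mem h h', by rw [smul_add, ← e, ← e', mul_add, add_mul]; abel⟩
  zero_mem' := ⟨f4.zero_mem, by simp⟩
  smul_mem' := by
    rintro r D ⟨h, e⟩
    exact ⟨f4.smul_mem r h, by rw [mul_smul_comm, smul_mul_assoc, ← smul_sub, e, smul_comm]⟩

/-- `𝔫⁻ = 𝔤_{-α} + 𝔤_{-2α}`. -/
def nMinus : Submodule ℝ (Module.End ℝ J) := rootSpace (-1) ⊔ rootSpace (-2)

/-- `g = exp D`: the exponential series of `D` converges to `g` at every point. -/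
def IsExp (D : Module.End ℝ J) (g : G) : Prop :=
  ∀ X : J, HasSum (fun k : ℕ => ((k.factorial : ℝ)⁻¹) • (D ^ k) X) ((g : J ≃ₗ[ℝ] J) X)

/-- The set `exp 𝔫⁻`. -/
def expNMinus : Set G := {g | ∃ D ∈ nMinus, IsExp D g}

/-- The subgroup `N⁻` of `F₄₍₋₂₀₎` with Lie algebra `𝔫⁻`, generated by `exp 𝔫⁻`. -/
def NMinus : Subgroup G := Subgroup.closure expNMinus

/-! ### The null cone `𝒩₁⁻` and the set `𝓕` of its rays -/

/-- The exceptional null cone `𝒩₁⁻`. -/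
def nullCone : Set J := {X | cross X X = 0 ∧ tr X = 0 ∧ ipJ E₁ X < 0}

/-- `P⁻ = h¹(-1, 1, 0; 0, 0, 1)`. -/
def PMinus : J := h1 (-1) 1 0 0 0 1

/-- `σ P⁻`. -/
def sigmaPMinus : J := (sigma : J ≃ₗ[ℝ] J) PMinus

theorem ne_zero_of_mem_nullCone {X : J} (hX : X ∈ nullCone) : X ≠ 0 := by
  rintro rfl
  have h := hX.2.2
  simp [ipJ, tr, jordan, h1, E₁, ip] at h

theorem PMinus_mem : PMinus ∈ nullCone := by
  refine ⟨?_, ?_, ?_⟩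
  · apply J_ext <;> simp [cross, jordan, PMinus, E, tr, ipJ, h1, ip_neg_left, ip_neg_right, conj_zero, ip_one_one, ip_zero]
  · simp [PMinus, h1, tr]
  · simp [jordan, PMinus, E₁, ipJ, tr, h1, ip_zero, zero_ip]

theorem sigmaPMinus_eq : sigmaPMinus = h1 (-1) 1 0 0 0 (-1) := by
  change sigmaLin PMinus = _
  simp [sigmaLin_apply, PMinus, h1]

theorem sigmaPMinus_mem : sigmaPMinus ∈ nullCone := by
  refine ⟨?_, ?_, ?_⟩
  · apply J_ext <;> simp [cross, jordan, sigmaPMinus_eq, E, tr, ipJ, h1, ip_neg_left, ip_neg_right, conj_zero, ip_one_one, ip_zero]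
  · simp [sigmaPMinus_eq, h1, tr]
  · simp [jordan, sigmaPMinus_eq, E₁, ipJ, tr, h1, ip_zero, zero_ip]

/-- The class `[X]` of `X ∈ 𝒩₁⁻` modulo multiplication by positive reals. Since `𝒩₁⁻` is stable
under positive multiples, this is the open half-line through `X`. -/
def cls (X : J) (hX : X ∈ nullCone) : Module.Ray ℝ J :=
  rayOfNeZero ℝ X (ne_zero_of_mem_nullCone hX)

/-- `𝓕 = 𝒩₁⁻ / ∼`, where `X ∼ Y` iff `Y = rX` for some `r > 0`, as a subset of the set of all
rays of `𝒥¹`. The group `F₄₍₋₂₀₎` acts on rays by `g [X] = [g X]`. -/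
def F : Set (Module.Ray ℝ J) := {q | ∃ X, ∃ hX : X ∈ nullCone, q = cls X hX}

end F4

end

/-! Let `H = A₃`. It acts on `J` with eigenvalues among 0, ±1, ±2, and the functional `phi X =
(X|σP⁻)` has weight 2 under it, while `σP⁻` is an eigenvector of eigenvalue -2. An element `D` of a
root space of weight -1 or -2 would make `phi ∘ D` an eigenfunctional of eigenvalue 3 or 4 and `D
σP⁻` an eigenvector of eigenvalue -3 or -4. Both therefore vanish, so every element of `N⁻`
preserves `phi` and fixes `σP⁻`.

On the null cone `X ∘ X = 0`, which expresses the norms of the octonion entries through the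
diagonal. Cauchy–Schwarz and the inequality of arithmetic and geometric means then give `phi ≥ 0`,
with equality only on the ray of `σP⁻` (`phi_nonneg`, `eq_smul_sigmaPMinus`). This separates the two
orbits and makes the second a single point.

Transitivity on `phi > 0` has two ingredients. First, a null vector with `phi > 0` is determined by
`phi`, the weight 1 coordinate `w = x₁ + conj x₂` and the imaginary part of `x₃`
(`eq_of_mem_nullCone`). Second, the explicit elements `D₁ a + D₂ p` of `𝔫⁻` are nilpotent, and their
exponentials move `w` and that imaginary part of `P⁻` to arbitrary values
(`exists_expNMinus_apply_PMinus`). After rescaling to `phi = 4 = phi P⁻`, one exponential suffices,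
so no products in `N⁻` are needed. -/

noncomputable section

/-! ### Octonion identities: composition, adjointness and the alternative laws. -/

namespace Octonion

instance : Module.Finite ℝ Octonion := inferInstanceAs (Module.Finite ℝ (ℍ[ℝ] × ℍ[ℝ]))

theorem ip_sub_left (x y z : Octonion) : ip (x - y) z = ip x z - ip y z := by
  rw [sub_eq_add_neg, ip_add_left, ip_neg_left, ← sub_eq_add_neg]

theorem ip_sub_right (x y z : Octonion) : ip x (y - z) = ip x y - ip x z := by
  rw [sub_eq_add_neg, ip_add_right, ip_neg_right, ← sub_eq_add_neg]

theorem conj_sub (x y : Octonion) : conj (x - y) = conj x - conj y := by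
  rw [sub_eq_add_neg, conj_add, conj_neg, ← sub_eq_add_neg]

theorem ip_conj_conj (x y : Octonion) : ip (conj x) (conj y) = ip x y := by
  simp [ip, Quaternion.inner_def]

theorem ip_conj_left (x y : Octonion) : ip (conj x) y = ip x (conj y) := by
  simp [ip, Quaternion.inner_def]

theorem ip_self_nonneg (x : Octonion) : 0 ≤ ip x x :=
  add_nonneg real_inner_self_nonneg real_inner_self_nonneg

theorem ip_self_eq_zero {x : Octonion} : ip x x = 0 ↔ x = 0 := by
  refine ⟨fun h => ?_, fun h => by rw [h, ip_zero]⟩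
  have h1 : 0 ≤ inner ℝ x.1 x.1 := real_inner_self_nonneg
  have h2 : 0 ≤ inner ℝ x.2 x.2 := real_inner_self_nonneg
  have h3 : inner ℝ x.1 x.1 + inner ℝ x.2 x.2 = 0 := h
  exact ext (inner_self_eq_zero (𝕜 := ℝ).1 (by linarith))
    (inner_self_eq_zero (𝕜 := ℝ).1 (by linarith))

theorem ip_eq_sum (x y : Octonion) : ip x y =
    x.1.re * y.1.re + x.1.imI * y.1.imI + x.1.imJ * y.1.imJ + x.1.imK * y.1.imK +
      (x.2.re * y.2.re + x.2.imI * y.2.imI + x.2.imJ * y.2.imJ + x.2.imK * y.2.imK) := by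
  rw [ip, Quaternion.inner_def, Quaternion.inner_def]
  simp only [Quaternion.re_mul, Quaternion.re_star, Quaternion.imI_star, Quaternion.imJ_star,
    Quaternion.imK_star]
  ring

/-- The product of octonions satisfies the composition law. -/
theorem ip_mul_mul_self (x y : Octonion) : ip (x * y) (x * y) = ip x x * ip y y := by
  simp [ip_eq_sum]
  ring

theorem ip_mul_self (x y : Octonion) : ip (x * y) x = ip x x * ip 1 y := by
  simp [ip_eq_sum]
  ring

theorem ip_mul_left_eq (x y z : Octonion) : ip (x * y) z = ip y (conj x * z) := by
  simp [ip_eq_sum]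
  ring

theorem eq_zero_or_eq_zero_of_mul_eq_zero {x y : Octonion} (h : x * y = 0) : x = 0 ∨ y = 0 := by
  have := ip_mul_mul_self x y
  rw [h, ip_zero, eq_comm, mul_eq_zero] at this
  simpa only [ip_self_eq_zero] using this

/-- The polarized form of the alternative law `(u x̄) x = |x|² u`. -/
theorem mul_conj_mul_add (u x y : Octonion) :
    (u * conj x) * y + (u * conj y) * x = (2 * ip x y) • u := by
  apply ext <;> ext <;> simp [ip_eq_sum] <;> ring

/-- The polarized form of the alternative law `x̄ (x u) = |x|² u`. -/
theorem mul_conj_mul_add' (u x y : Octonion) :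
    conj y * (x * u) + conj x * (y * u) = (2 * ip x y) • u := by
  apply ext <;> ext <;> simp [ip_eq_sum] <;> ring

end Octonion

/-! ### Weights of `A₃` and the invariants of `N⁻`. -/

namespace F4

open Octonion

/-- The polynomial t(t² - 1)(t² - 4) annihilates `A₃`, so only 0, ±1, ±2 can occur as weights. The
two lemmas that follow exclude any other eigenvalue, for vectors and for functionals. -/
theorem A₃_pow_five (X : J) :
    A₃ (A₃ (A₃ (A₃ (A₃ X)))) = (5 : ℝ) • A₃ (A₃ (A₃ X)) - (4 : ℝ) • A₃ X := by
  apply J_ext <;> simp [A₃_apply, h1, conj_smul, conj_conj, ip_smul_right, ip_one_one,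
    conj_one] <;> first | ring1 | module

theorem eq_zero_of_A₃_eigenvector {X : J} {c : ℝ} (hc : c ^ 5 - 5 * c ^ 3 + 4 * c ≠ 0)
    (h : A₃ X = c • X) : X = 0 := by
  have := A₃_pow_five X
  simp only [h, map_smul, smul_smul] at this
  have h2 : (c ^ 5 - 5 * c ^ 3 + 4 * c) • X = 0 := by
    linear_combination (norm := module) this
  exact (smul_eq_zero.1 h2).resolve_left hc

theorem eq_zero_of_comp_A₃ {f : J →ₗ[ℝ] ℝ} {c : ℝ} (hc : c ^ 5 - 5 * c ^ 3 + 4 * c ≠ 0)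
    (h : ∀ X, f (A₃ X) = c * f X) : f = 0 := by
  refine LinearMap.ext fun X => ?_
  have := congrArg f (A₃_pow_five X)
  simp only [map_sub, map_smul, h, smul_eq_mul] at this
  have h2 : (c ^ 5 - 5 * c ^ 3 + 4 * c) * f X = 0 := by linear_combination this
  exact (mul_eq_zero.1 h2).resolve_left hc

/-- The functional `X ↦ (X|σP⁻)`. -/
def phi : J →ₗ[ℝ] ℝ where
  toFun X := X.1 1 - X.1 0 + 2 * ip 1 (X.2 2)
  map_add' X Y := by simp [ip_add_right]; ring
  map_smul' r X := by simp [ip_smul_right]; ring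

theorem phi_apply (X : J) : phi X = X.1 1 - X.1 0 + 2 * ip 1 (X.2 2) := rfl

theorem ipJ_sigmaPMinus (X : J) : ipJ X sigmaPMinus = phi X := by
  simp [phi_apply, sigmaPMinus_eq, ipJ, jordan, tr, h1, ip_zero, ip_neg_right, ip_comm _ 1]
  ring

theorem ipJ_E₁ (X : J) : ipJ E₁ X = X.1 0 := by
  simp [E₁, ipJ, jordan, tr, h1, zero_ip]

theorem phi_A₃ (X : J) : phi (A₃ X) = 2 * phi X := by
  simp [phi_apply, A₃_apply, h1, ip_smul_right, ip_one_one]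
  ring

theorem A₃_sigmaPMinus : A₃ sigmaPMinus = (-2 : ℝ) • sigmaPMinus := by
  apply J_ext <;> simp [sigmaPMinus_eq, A₃_apply, h1, ip_neg_right, ip_one_one, conj_zero]
  module

/-- Since `phi` has weight 2, the bracket relation gives `phi ∘ D` the eigenvalue 2 - c. For c = -1,
-2 this is 3 or 4, which is not a weight. -/
theorem phi_comp_of_mem_rootSpace {c : ℝ} (hc : (2 - c) ^ 5 - 5 * (2 - c) ^ 3 + 4 * (2 - c) ≠ 0)
    {D : Module.End ℝ J} (hD : D ∈ rootSpace c) (X : J) : phi (D X) = 0 := by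
  suffices h : phi ∘ₗ D = 0 from LinearMap.congr_fun h X
  refine eq_zero_of_comp_A₃ hc fun Y => ?_
  have h2 := congrArg phi (LinearMap.congr_fun hD.2 Y)
  simp only [LinearMap.sub_apply, Module.End.mul_apply, LinearMap.smul_apply, map_sub, map_smul,
    phi_A₃, smul_eq_mul] at h2
  simp only [LinearMap.comp_apply]
  linear_combination -h2

theorem apply_sigmaPMinus_of_mem_rootSpace {c : ℝ}
    (hc : (c - 2) ^ 5 - 5 * (c - 2) ^ 3 + 4 * (c - 2) ≠ 0)
    {D : Module.End ℝ J} (hD : D ∈ rootSpace c) : D sigmaPMinus = 0 := by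
  refine eq_zero_of_A₃_eigenvector hc ?_
  have h2 := LinearMap.congr_fun hD.2 sigmaPMinus
  simp only [LinearMap.sub_apply, Module.End.mul_apply, LinearMap.smul_apply, A₃_sigmaPMinus,
    map_smul] at h2
  linear_combination (norm := module) h2

theorem phi_comp_of_mem_nMinus {D : Module.End ℝ J} (hD : D ∈ nMinus) (X : J) :
    phi (D X) = 0 := by
  obtain ⟨D₁, h₁, D₂, h₂, rfl⟩ := Submodule.mem_sup.1 hD
  rw [LinearMap.add_apply, map_add, phi_comp_of_mem_rootSpace (by norm_num) h₁,
    phi_comp_of_mem_rootSpace (by norm_num) h₂, add_zero]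

theorem apply_sigmaPMinus_of_mem_nMinus {D : Module.End ℝ J} (hD : D ∈ nMinus) :
    D sigmaPMinus = 0 := by
  obtain ⟨D₁, h₁, D₂, h₂, rfl⟩ := Submodule.mem_sup.1 hD
  rw [LinearMap.add_apply, apply_sigmaPMinus_of_mem_rootSpace (by norm_num) h₁,
    apply_sigmaPMinus_of_mem_rootSpace (by norm_num) h₂, add_zero]

/-- Every term of the exponential series beyond the constant one kills `σP⁻`; the statement then
passes to the generated subgroup. The invariance of `phi` is proved dually, with the leftmost factor
of `D ^ k` killed by `phi`. -/
theorem apply_sigmaPMinus_of_mem_NMinus {g : G} (hg : g ∈ NMinus) :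
    (g : J ≃ₗ[ℝ] J) sigmaPMinus = sigmaPMinus := by
  induction hg using Subgroup.closure_induction with
  | mem g hg =>
    obtain ⟨D, hD, h⟩ := hg
    refine (h sigmaPMinus).unique ?_
    convert hasSum_single 0 ?_ using 1
    · simp
    · rintro (_ | k) hk
      · exact absurd rfl hk
      · rw [pow_succ, Module.End.mul_apply, apply_sigmaPMinus_of_mem_nMinus hD, map_zero, smul_zero]
  | one => rfl
  | mul x y _ _ hx hy =>
    rw [Subgroup.coe_mul, LinearEquiv.mul_apply, hy, hx]
  | inv x _ hx =>
    rw [Subgroup.coe_inv]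
    exact (LinearEquiv.symm_apply_eq _).2 hx.symm

theorem phi_apply_of_mem_NMinus {g : G} (hg : g ∈ NMinus) (X : J) :
    phi ((g : J ≃ₗ[ℝ] J) X) = phi X := by
  induction hg using Subgroup.closure_induction generalizing X with
  | mem g hg =>
    obtain ⟨D, hD, h⟩ := hg
    have hc : Continuous phi := phi.continuous_of_finiteDimensional
    refine ((h X).map phi.toAddMonoidHom hc).unique ?_
    convert hasSum_single 0 ?_ using 1
    · simp
    · rintro (_ | k) hk
      · exact absurd rfl hk
      · simp [pow_succ', phi_comp_of_mem_nMinus hD]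
  | one => rfl
  | mul x y _ _ hx hy =>
    rw [Subgroup.coe_mul, LinearEquiv.mul_apply, hx, hy]
  | inv x _ hx =>
    rw [← hx, Subgroup.coe_inv]
    exact congrArg phi (LinearEquiv.apply_symm_apply _ _)

/-! ### Explicit elements of the root spaces of weights -1 and -2. -/

/-- The rotation `X ↦ [a e₂₃ - ā e₃₂, X]`. -/
def A₁ (a : Octonion) : Module.End ℝ J where
  toFun X := h1 0 (2 * ip a (X.2 0)) (-2 * ip a (X.2 0))
    ((X.1 2 - X.1 1) • a) (-conj (X.2 2 * a)) (conj (a * X.2 1))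
  map_add' X Y := by
    apply J_ext <;> simp [h1, conj_add, ip_add_right, add_mul, mul_add] <;>
      first | ring1 | module
  map_smul' r X := by
    apply J_ext <;> simp [h1, conj_smul, ip_smul_right, smul_mul_assoc, mul_smul_comm] <;>
      first | ring1 | module

theorem A₁_apply (a : Octonion) (X : J) : A₁ a X = h1 0 (2 * ip a (X.2 0)) (-2 * ip a (X.2 0))
    ((X.1 2 - X.1 1) • a) (-conj (X.2 2 * a)) (conj (a * X.2 1)) := rfl

/-- On the diagonal, the Leibniz rule needs only the adjointness and cyclicity of the trilinear form
given by the product and `ip`. Nonassociativity enters in the three octonion coordinates, where the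
polarized alternative laws settle it. -/
theorem A₁_mem (a : Octonion) : A₁ a ∈ f4 := by
  intro X Y
  have t₁ (x y : Octonion) : ip (conj a * conj x) y = ip x (conj y * conj a) := by
    rw [ip_mul_left_eq, conj_conj, ip_conj_left, Octonion.conj_mul]
  have t₂ (x y : Octonion) : ip a (conj x * conj y) = ip x (conj y * conj a) := by
    simp [ip_eq_sum]
    ring
  apply J_ext <;> simp only [A₁_apply, jordan, h1]
  all_goals simp [conj_add, conj_smul, conj_neg, conj_sub, sub_eq_add_neg, Octonion.conj_mul,
    conj_conj, smul_mul_assoc, mul_smul_comm, add_mul, mul_add,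
    ip_add_right, ip_add_left, ip_smul_right, ip_smul_left, ip_neg_left, ip_neg_right]
  · linear_combination ip_comm (conj (X.2 1) * conj a) (Y.2 2) - t₁ (Y.2 2) (X.2 1)
      - t₁ (X.2 2) (Y.2 1) - ip_comm (X.2 1) (conj a * conj (Y.2 2))
  · linear_combination ip_comm (conj (X.2 1) * conj a) (Y.2 2) - t₂ (X.2 2) (Y.2 1)
      - t₂ (Y.2 2) (X.2 1) + (Y.1 2 - Y.1 1) * ip_comm a (X.2 0)
  · linear_combination t₂ (X.2 2) (Y.2 1) + t₂ (Y.2 2) (X.2 1) - t₁ (X.2 2) (Y.2 1)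
      - t₁ (Y.2 2) (X.2 1) - ip_comm (X.2 1) (conj a * conj (Y.2 2))
      + (Y.1 2 - Y.1 1) * ip_comm a (X.2 0)
  · have e := mul_conj_mul_add a (conj (X.2 1)) (conj (Y.2 1))
    simp only [conj_conj, ip_conj_conj] at e
    linear_combination (norm := module)
      (2⁻¹ : ℝ) • e - (2⁻¹ : ℝ) • mul_conj_mul_add' a (X.2 2) (Y.2 2)
  · linear_combination (norm := module) (-2⁻¹ : ℝ) • mul_conj_mul_add' (X.2 1) a (Y.2 0)
      - (2⁻¹ : ℝ) • mul_conj_mul_add' (Y.2 1) a (X.2 0)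
  · have e (u x : Octonion) := mul_conj_mul_add u (conj x) (conj a)
    simp only [conj_conj, ip_conj_conj, ip_comm _ a] at e
    linear_combination (norm := module) (2⁻¹ : ℝ) • e (X.2 2) (Y.2 0)
      + (2⁻¹ : ℝ) • e (Y.2 2) (X.2 0)

theorem commutator_mem_f4 {D D' : Module.End ℝ J} (h : D ∈ f4) (h' : D' ∈ f4) :
    D * D' - D' * D ∈ f4 := by
  intro X Y
  have k : ∀ A B, D (jordan A B) = jordan (D A) B + jordan A (D B) := h
  have k' : ∀ A B, D' (jordan A B) = jordan (D' A) B + jordan A (D' B) := h'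
  have s₁ (A B C : J) : jordan (A - B) C = jordan A C - jordan B C := by
    rw [eq_sub_iff_add_eq, ← jordan_add_left, sub_add_cancel]
  have s₂ (A B C : J) : jordan C (A - B) = jordan C A - jordan C B := by
    rw [eq_sub_iff_add_eq, ← jordan_add_right, sub_add_cancel]
  simp only [LinearMap.sub_apply, Module.End.mul_apply, k, k', map_add, s₁, s₂]
  abel

/-- The element of `𝔤_{-α}` with parameter `a`. -/
def D₁ (a : Octonion) : Module.End ℝ J := A₁ a - (A₃ * A₁ a - A₁ a * A₃)

theorem D₁_apply (a : Octonion) (X : J) : D₁ a X =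
    h1 (2 * ip (conj a) (X.2 1)) (2 * ip a (X.2 0)) (-2 * ip a (X.2 0) - 2 * ip (conj a) (X.2 1))
      ((X.1 2 - X.1 1) • a - conj (X.2 2) * a) ((X.1 0 - X.1 2) • conj a - conj (X.2 2 * a))
      (conj (a * X.2 1) - a * conj (X.2 0)) := by
  have r (x y : Octonion) : (2 * ip 1 x) • y = x * y + conj x * y := by
    rw [← add_mul, add_conj, smul_mul_assoc, Octonion.one_mul]
  simp only [D₁, LinearMap.sub_apply, Module.End.mul_apply]
  apply J_ext <;> simp [A₁_apply, A₃_apply, h1, Octonion.conj_mul, conj_conj, conj_neg, conj_smul,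
    ip_conj_left, ip_one_mul, Octonion.mul_one, Octonion.one_mul, mul_smul_comm,
    smul_mul_assoc, ip_neg_right, ip_one_conj, ← ip_comm (conj (X.2 1))]
  · linear_combination (norm := module) r (X.2 2) a
  · module
  · rw [← mul_conj_add]
    abel

/-- The element of `𝔤_{-2α}` with parameter `p`. -/
def D₂ (p : Octonion) : Module.End ℝ J := (-1 / 2 : ℝ) • (D₁ 1 * D₁ p - D₁ p * D₁ 1)

/-- The factor -1/2 in `D₂` is chosen so that, for imaginary `p`, the imaginary part of the last
entry is exactly `phi X • p`. -/
theorem D₂_apply {p : Octonion} (hp : conj p = -p) (X : J) : D₂ p X =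
    h1 (-2 * ip p (X.2 2)) (2 * ip p (X.2 2)) 0
      (-(p * (X.2 0 + conj (X.2 1)))) (conj (p * (X.2 0 + conj (X.2 1))))
      (phi X • p - (2 * ip p (X.2 2)) • 1) := by
  have h1p : ip 1 p = 0 := by
    have := ip_one_conj p
    rw [hp, ip_neg_right] at this
    linarith
  have hp1 : ip p 1 = 0 := by rw [ip_comm, h1p]
  have hp0 : p.1.re = 0 := by simpa [ip_eq_sum] using h1p
  have e₁ (x : Octonion) : (2 * ip p x) • (1 : Octonion) = p * conj x - x * p := by
    rw [← mul_conj_add, hp, mul_neg, sub_eq_add_neg]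
  have e₂ (x : Octonion) : (2 * ip 1 x) • p = p * x + p * conj x := by
    rw [← mul_add, add_conj, mul_smul_comm, Octonion.mul_one]
  have e₃ (x : Octonion) : (2 * ip 1 x) • p = x * p + conj x * p := by
    rw [← add_mul, add_conj, smul_mul_assoc, Octonion.one_mul]
  simp only [D₂, LinearMap.sub_apply, LinearMap.smul_apply, Module.End.mul_apply]
  apply J_ext <;> simp [D₁_apply, phi_apply, h1, Octonion.conj_mul, conj_conj, conj_neg, conj_smul,
    conj_sub, conj_add, ip_sub_right, ip_sub_left, ip_smul_right, ip_neg_right, ip_neg_left, hp, h1p, hp1, conj_one,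
    ip_one_mul, Octonion.mul_one, Octonion.one_mul, mul_smul_comm, mul_sub, sub_mul, mul_add, add_mul,
    smul_mul_assoc, ip_one_conj, ip_one_one]
  · simp [ip_eq_sum, hp0]
    ring
  · simp [ip_eq_sum, hp0]
    ring
  · simp [ip_eq_sum, hp0]
    ring
  · linear_combination (norm := module) e₁ (X.2 0) - (2⁻¹ : ℝ) • e₁ (X.2 1)
      - e₂ (X.2 0) - (2⁻¹ : ℝ) • e₂ (X.2 1)
  · linear_combination (norm := module) e₁ (X.2 1) - (2⁻¹ : ℝ) • e₁ (X.2 0)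
      - e₂ (X.2 1) - e₃ (X.2 0) + (2⁻¹ : ℝ) • e₂ (X.2 0)
  · linear_combination (norm := module) e₁ (X.2 2) - e₂ (X.2 2)

/-- `A₁ a` has only components of weights 1 and -1 under bracketing with `A₃`. Subtracting its
bracket cancels the first and doubles the second. -/
theorem D₁_mem_rootSpace (a : Octonion) : D₁ a ∈ rootSpace (-1) := by
  refine ⟨f4.sub_mem (A₁_mem a) (commutator_mem_f4 A₃_mem (A₁_mem a)), LinearMap.ext fun X => ?_⟩
  have l (x y : Octonion) : (2 * ip 1 x) • y = x * y + conj x * y := by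
    rw [← add_mul, add_conj, smul_mul_assoc, Octonion.one_mul]
  have r (x y : Octonion) : (2 * ip 1 x) • y = y * x + y * conj x := by
    rw [← mul_add, add_conj, mul_smul_comm, Octonion.mul_one]
  simp only [LinearMap.sub_apply, LinearMap.smul_apply, Module.End.mul_apply]
  apply J_ext <;> simp [D₁_apply, A₃_apply, h1, Octonion.conj_mul, conj_conj, conj_neg, conj_smul,
    conj_sub, ip_sub_right, ip_smul_right, ip_conj_left, ip_neg_right, conj_one, ip_one_mul,
    Octonion.mul_one, Octonion.one_mul, mul_smul_comm, smul_mul_assoc, ip_one_conj]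
  · rw [ip_comm _ (conj a), ip_conj_left]
    ring
  · rw [ip_comm _ (conj a), ip_conj_left]
    ring
  · ring
  · linear_combination (norm := module) l (X.2 2) a
  · linear_combination (norm := module) r (X.2 2) (conj a)
  · have e := mul_conj_add a (conj (X.2 1))
    rw [conj_conj] at e
    linear_combination (norm := module) e - mul_conj_add a (X.2 0)

/-- Weights add under brackets: moving `A₃` past each of the two factors contributes -1. -/
theorem D₂_mem_rootSpace (p : Octonion) : D₂ p ∈ rootSpace (-2) := by
  refine (rootSpace (-2)).smul_mem _ ⟨commutator_mem_f4 (D₁_mem_rootSpace 1).1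
    (D₁_mem_rootSpace p).1, ?_⟩
  have e₁ := (D₁_mem_rootSpace 1).2
  have e₂ := (D₁_mem_rootSpace p).2
  rw [sub_eq_iff_eq_add] at e₁ e₂
  simp only [mul_sub, sub_mul, ← mul_assoc, e₁, e₂, add_mul]
  simp only [mul_assoc, e₁, e₂, mul_add, mul_smul_comm, smul_mul_assoc]
  module

theorem D₁_add_D₂_mem_nMinus (a p : Octonion) : D₁ a + D₂ p ∈ nMinus :=
  Submodule.add_mem_sup (D₁_mem_rootSpace a) (D₂_mem_rootSpace p)

/-! ### Action of `D₁ a + D₂ p` in weight coordinates, and nilpotency. -/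

theorem tr_D (a : Octonion) {p : Octonion} (hp : conj p = -p) (X : J) :
    tr ((D₁ a + D₂ p) X) = 0 := by
  simp [LinearMap.add_apply, D₁_apply, D₂_apply hp, tr, h1]
  ring

/-- The component of weight `1`. -/
theorem weight_one_D (a : Octonion) {p : Octonion} (hp : conj p = -p) (X : J) :
    ((D₁ a + D₂ p) X).2 0 + conj (((D₁ a + D₂ p) X).2 1) = -phi X • a := by
  simp [LinearMap.add_apply, D₁_apply, D₂_apply hp, h1, phi_apply, conj_add, conj_sub, conj_smul,
    conj_conj, Octonion.conj_mul, mul_add, conj_neg, hp]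
  have l : (2 * ip 1 (X.2 2)) • a = X.2 2 * a + conj (X.2 2) * a := by
    rw [← add_mul, add_conj, smul_mul_assoc, Octonion.one_mul]
  linear_combination (norm := module) l

theorem xi₃_D (a : Octonion) {p : Octonion} (hp : conj p = -p) (X : J) :
    ((D₁ a + D₂ p) X).1 2 = -2 * ip a (X.2 0 + conj (X.2 1)) := by
  simp [LinearMap.add_apply, D₁_apply, D₂_apply hp, h1, ip_add_right, ip_conj_left]
  ring

theorem im_D (a : Octonion) {p : Octonion} (hp : conj p = -p) (X : J) :
    ((D₁ a + D₂ p) X).2 2 - conj (((D₁ a + D₂ p) X).2 2) = (2 * phi X) • p +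
    ((X.2 0 + conj (X.2 1)) * conj a - a * conj (X.2 0 + conj (X.2 1))) := by
  simp [LinearMap.add_apply, D₁_apply, D₂_apply hp, h1, conj_add, conj_sub, conj_smul,
    conj_conj, Octonion.conj_mul, mul_add, add_mul, hp, conj_one]
  module

theorem weight_neg_one_D (a : Octonion) {p : Octonion} (hp : conj p = -p) (X : J) :
    ((D₁ a + D₂ p) X).2 0 - conj (((D₁ a + D₂ p) X).2 1) =
    (3 * X.1 2 - tr X) • a + (X.2 2 - conj (X.2 2)) * a
      - (2 : ℝ) • (p * (X.2 0 + conj (X.2 1))) := by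
  simp [LinearMap.add_apply, D₁_apply, D₂_apply hp, h1, tr, conj_add, conj_sub, conj_smul,
    conj_conj, Octonion.conj_mul, mul_add, sub_mul, conj_neg, hp]
  module

theorem weight_neg_two_D (a : Octonion) {p : Octonion} (hp : conj p = -p) (X : J) :
    ((D₁ a + D₂ p) X).1 1 - ((D₁ a + D₂ p) X).1 0
      - 2 * ip 1 (((D₁ a + D₂ p) X).2 2) =
    4 * ip a (X.2 0 - conj (X.2 1)) + 4 * ip p (X.2 2 - conj (X.2 2)) := by
  have h1p : ip 1 p = 0 := by
    have := ip_one_conj p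
    rw [hp, ip_neg_right] at this
    linarith
  simp [LinearMap.add_apply, D₁_apply, D₂_apply hp, h1, ip_add_right, ip_sub_right, ip_smul_right,
    ip_conj_left, ip_one_mul, ip_one_conj, h1p, ip_one_one, ← ip_conj_left p, hp, ip_neg_left, conj_conj]
  ring

/-- The weight coordinates form a complete system: besides `tr` there are `phi` (weight 2), `w`
(weight 1), `ξ₃` and the imaginary part of `x₃` (weight 0), `x₁ - conj x₂` (weight -1) and `ξ₂ - ξ₁
- 2(1|x₃)` (weight -2). -/
theorem eq_zero_of_coordinates {X : J} (ht : tr X = 0) (hφ : phi X = 0)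
    (hw : X.2 0 + conj (X.2 1) = 0) (hξ : X.1 2 = 0) (hU : X.2 2 - conj (X.2 2) = 0)
    (hv : X.2 0 - conj (X.2 1) = 0) (hψ : X.1 1 - X.1 0 - 2 * ip 1 (X.2 2) = 0) : X = 0 := by
  rw [phi_apply] at hφ
  rw [tr] at ht
  have h0 : X.2 0 = 0 := by linear_combination (norm := module) (2⁻¹ : ℝ) • (hw + hv)
  have h1 : X.2 1 = 0 := by
    rw [← conj_conj (X.2 1), ← conj_zero]
    congr 1
    linear_combination (norm := module) hw - h0
  have h2 : X.2 2 = 0 := by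
    have e : 2 * ip 1 (X.2 2) = 0 := by linear_combination (hφ - hψ) / 2
    have := add_conj (X.2 2)
    rw [e, zero_smul] at this
    linear_combination (norm := module) (2⁻¹ : ℝ) • (hU + this)
  rw [h2, ip_zero] at hφ
  exact J_ext (by simp; linarith) (by simp; linarith) hξ h0 h1 h2

/-- A coordinate of `D X` depends only on coordinates of `X` of strictly higher weight, apart from
`tr`, which `D` annihilates. The weights 2, 1, 0, -1, -2 therefore vanish in turn after one to five
applications. -/
theorem D_pow_five (a : Octonion) {p : Octonion} (hp : conj p = -p) : (D₁ a + D₂ p) ^ 5 = 0 := by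
  have hφ X := phi_comp_of_mem_nMinus (D₁_add_D₂_mem_nMinus a p) X
  have ht X := tr_D a hp X
  have hw X := weight_one_D a hp X
  have hξ X := xi₃_D a hp X
  have hU X := im_D a hp X
  have hv X := weight_neg_one_D a hp X
  have hψ X := weight_neg_two_D a hp X
  generalize D₁ a + D₂ p = D at *
  have hw' X : (D (D X)).2 0 + conj ((D (D X)).2 1) = 0 := by rw [hw, hφ, neg_zero, zero_smul]
  have hξ' X : (D (D (D X))).1 2 = 0 := by rw [hξ, hw', ip_zero, mul_zero]
  have hU' X : (D (D (D X))).2 2 - conj ((D (D (D X))).2 2) = 0 := by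
    rw [hU, hφ, hw', mul_zero, zero_smul, zero_mul, conj_zero, mul_zero, sub_zero, add_zero]
  have hv' X : (D (D (D (D X)))).2 0 - conj ((D (D (D (D X)))).2 1) = 0 := by
    rw [hv, hξ', ht, hU', hw']
    simp
  refine LinearMap.ext fun X => ?_
  change D (D (D (D (D X)))) = 0
  refine eq_zero_of_coordinates (ht _) (hφ _) (hw' _) (hξ' _) (hU' _) (hv' _) ?_
  rw [hψ, hv', hU', ip_zero, ip_zero, mul_zero, add_zero]

/-! ### Exponentials of nilpotent derivations. -/

/-- The Jordan algebra `𝒥¹`, with the Jordan product as its multiplication. -/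
def JordanJ : Type := J

namespace JordanJ

instance : AddCommGroup JordanJ := inferInstanceAs (AddCommGroup J)
instance : Module ℝ JordanJ := inferInstanceAs (Module ℝ J)
instance : Module ℚ JordanJ := Module.compHom JordanJ (algebraMap ℚ ℝ)
instance : Mul JordanJ := ⟨fun X Y : J => (jordan X Y : J)⟩

instance : NonUnitalNonAssocRing JordanJ where
  left_distrib := jordan_add_right
  right_distrib := jordan_add_left
  zero_mul X := by
    have h := jordan_smul_left 0 0 X
    rw [zero_smul, zero_smul] at h
    exact h
  mul_zero X := by
    have h := jordan_smul_right 0 X 0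
    rw [zero_smul, zero_smul] at h
    exact h

instance : SMulCommClass ℝ JordanJ JordanJ := ⟨fun r X Y => (jordan_smul_right r X Y).symm⟩
instance : IsScalarTower ℝ JordanJ JordanJ := ⟨jordan_smul_left⟩

end JordanJ

/-- The exponential of a nilpotent derivation is a finite sum, is multiplicative, and has inverse
the exponential of `-D`; hence it lies in `G`. -/
theorem exists_isExp {D : Module.End ℝ J} (hD : D ∈ f4) (hn : IsNilpotent D) :
    ∃ g : G, IsExp D g := by
  let D' : Module.End ℝ JordanJ := D
  have hn' : IsNilpotent D' := hn
  let e : JordanJ ≃ₗ[ℝ] JordanJ := LinearEquiv.ofLinearMap (IsNilpotent.exp D') (IsNilpotent.exp (-D'))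
    (IsNilpotent.exp_mul_exp_neg_self hn') (IsNilpotent.exp_neg_mul_exp_self hn')
  have hmul (X Y : JordanJ) : e (X * Y) = e X * e Y :=
    Module.End.exp_mul_of_derivation ℝ JordanJ D'
      (fun x y => (hD x y).trans (add_comm _ _)) hn' X Y
  refine ⟨⟨e, hmul⟩, fun X => ?_⟩
  obtain ⟨k, hk⟩ := hn
  have hk' : D' ^ k = 0 := hk
  have he (Y : JordanJ) : e Y = ∑ i ∈ Finset.range k, ((i.factorial : ℝ)⁻¹) • (D' ^ i) Y := by
    change IsNilpotent.exp D' Y = _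
    rw [IsNilpotent.exp_eq_sum hk', LinearMap.sum_apply]
    refine Finset.sum_congr rfl fun i _ => ?_
    -- `IsNilpotent.exp` has rational coefficients, and the rational structure on `JordanJ` is the
    -- restriction of the real one.
    change (((i.factorial : ℚ)⁻¹ : ℚ) : ℝ) • (D' ^ i) Y = _
    push_cast
    rfl
  have hs : HasSum (fun i : ℕ => ((i.factorial : ℝ)⁻¹) • (D ^ i) X)
      (∑ i ∈ Finset.range k, ((i.factorial : ℝ)⁻¹) • (D ^ i) X) := by
    refine hasSum_sum_of_ne_finset_zero fun i hi => ?_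
    rw [pow_eq_zero_of_le (by simpa using hi) hk, LinearMap.zero_apply, smul_zero]
  exact (he X) ▸ hs

/-! ### Geometry of the null cone. -/

/-- With zero trace, `X × X = 0` says that `X ∘ X` equals `(X|X)/2 • E`. Taking traces gives `(X|X)
= (3/2)(X|X)`, so the scalar is zero. -/
theorem jordan_self_of_mem_nullCone {X : J} (hX : X ∈ nullCone) : jordan X X = 0 := by
  obtain ⟨hc, ht, -⟩ := hX
  have h : jordan X X = (ipJ X X / 2) • E := by
    rw [cross, ht] at hc
    linear_combination (norm := module) hc
  have h2 := congrArg tr h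
  change ipJ X X = _ at h2
  simp only [tr, E, h1, Prod.smul_fst, Pi.smul_apply, smul_eq_mul, Matrix.cons_val] at h2
  rw [h, show ipJ X X = 0 by linarith, zero_div, zero_smul]

/-- Taking norms of the off-diagonal equations, with the composition law, leaves a polynomial system
in the diagonal entries and the three squared norms. Even the vanishing of the trace follows from
it. -/
theorem norms_of_jordan_self {X : J} (h : jordan X X = 0) :
    tr X = 0 ∧ ip (X.2 0) (X.2 0) = X.1 1 * X.1 2 ∧ ip (X.2 1) (X.2 1) = -X.1 0 * X.1 2 ∧
      ip (X.2 2) (X.2 2) = -X.1 0 * X.1 1 ∧ -X.1 0 • X.2 0 = conj (X.2 1 * X.2 2) := by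
  have e₀ := congrArg (fun Z : J => Z.1 0) h
  have e₁ := congrArg (fun Z : J => Z.1 1) h
  have e₂ := congrArg (fun Z : J => Z.1 2) h
  have f₀ := congrArg (fun Z : J => Z.2 0) h
  have f₁ := congrArg (fun Z : J => Z.2 1) h
  have f₂ := congrArg (fun Z : J => Z.2 2) h
  simp only [jordan, h1, Matrix.cons_val, Prod.fst_zero, Prod.snd_zero, Pi.zero_apply, conj_add]
    at e₀ e₁ e₂ f₀ f₁ f₂
  replace f₀ : (X.1 1 + X.1 2) • X.2 0 = conj (X.2 1 * X.2 2) := by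
    linear_combination (norm := module) f₀
  replace f₁ : (X.1 2 + X.1 0) • X.2 1 = -conj (X.2 2 * X.2 0) := by
    linear_combination (norm := module) f₁
  replace f₂ : (X.1 0 + X.1 1) • X.2 2 = -conj (X.2 0 * X.2 1) := by
    linear_combination (norm := module) f₂
  have n₀ := congrArg (fun z => ip z z) f₀
  have n₁ := congrArg (fun z => ip z z) f₁
  have n₂ := congrArg (fun z => ip z z) f₂
  simp only [ip_smul_left, ip_smul_right, ip_neg_left, ip_neg_right, ip_conj_conj,
    ip_mul_mul_self, neg_neg] at n₀ n₁ n₂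
  rw [tr]
  generalize X.1 0 = x, X.1 1 = y, X.1 2 = z, ip (X.2 0) (X.2 0) = a,
    hb : ip (X.2 1) (X.2 1) = b, hc : ip (X.2 2) (X.2 2) = c at *
  have hb : b = z ^ 2 + a := by linarith
  have hc : c = y ^ 2 + a := by linarith
  have ha : a = y * z := by
    rw [hb, hc] at n₀
    -- After eliminating `b` and `c`, the first norm equation is a quadratic in `a` with the double
    -- root `y z`.
    have : (a - y * z) ^ 2 = 0 := by linear_combination -n₀
    have := pow_eq_zero_iff (two_ne_zero) |>.1 this
    linarith
  have hx : (x - (y + z)) * (x + (y + z)) = 0 := by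
    linear_combination e₀ + hb + hc + 2 * ha
  have ht : x + y + z = 0 := by
    rcases mul_eq_zero.1 hx with hx | hx
    · have hx : x = y + z := by linarith
      rw [hb, hc, ha, hx] at n₁ n₂
      have hz : 4 * (z ^ 2 * (y + z) ^ 2) = 0 := by linear_combination n₁
      have hy : 4 * (y ^ 2 * (y + z) ^ 2) = 0 := by linear_combination n₂
      -- Adding `hy` and `hz` gives (y² + z²)(y + z)² = 0, and (y + z)² ≤ 2(y² + z²).
      have : (y + z) ^ 4 = 0 := by nlinarith [sq_nonneg ((y - z) * (y + z)), sq_nonneg ((y + z) ^ 2)]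
      have := pow_eq_zero_iff (by norm_num) |>.1 this
      linarith
    · linarith
  obtain rfl : x = -(y + z) := by linarith
  refine ⟨ht, ha, by rw [hb, ha]; ring, by rw [hc, ha]; ring, ?_⟩
  rw [neg_neg]
  exact f₀

theorem eq_zero_of_jordan_self {X : J} (h : jordan X X = 0) (h0 : X.1 0 = 0) : X = 0 := by
  obtain ⟨ht, h₀, h₁, h₂, -⟩ := norms_of_jordan_self h
  rw [h0, neg_zero, zero_mul, ip_self_eq_zero] at h₁ h₂
  rw [tr, h0] at ht
  have hz : X.1 2 = -X.1 1 := by linarith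
  have hn := ip_self_nonneg (X.2 0)
  rw [h₀, hz] at hn
  have hy : X.1 1 = 0 := by nlinarith
  rw [hy, zero_mul, ip_self_eq_zero] at h₀
  exact J_ext h0 hy (by rw [hz, hy, neg_zero]; rfl) h₀ h₁ h₂

theorem mem_nullCone_of_jordan_self {X : J} (h : jordan X X = 0) (h0 : X.1 0 < 0) :
    X ∈ nullCone := by
  have ht := (norms_of_jordan_self h).1
  refine ⟨?_, ht, by rwa [ipJ_E₁]⟩
  rw [cross, ipJ, h, ht]
  simp [tr]

theorem sq_ip_one_le (x : Octonion) : ip 1 x ^ 2 ≤ ip x x := by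
  have h := ip_self_nonneg (x - ip 1 x • 1)
  simp only [ip_sub_left, ip_sub_right, ip_smul_left, ip_smul_right, ip_one_one, ip_comm _ 1] at h
  linarith

/-- Cauchy–Schwarz gives (1|x₃)² ≤ |x₃|² = -ξ₁ξ₂, and 4(-ξ₁ξ₂) ≤ (ξ₂ - ξ₁)². The signs ξ₁ < 0 ≤ ξ₂
allow taking square roots. -/
theorem phi_nonneg {X : J} (hX : X ∈ nullCone) : 0 ≤ phi X := by
  obtain ⟨-, -, -, h₂, -⟩ := norms_of_jordan_self (jordan_self_of_mem_nullCone hX)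
  have h0 : X.1 0 < 0 := by simpa [ipJ_E₁] using hX.2.2
  have hn := ip_self_nonneg (X.2 2)
  have h1 : 0 ≤ X.1 1 := by
    rw [h₂] at hn
    exact nonneg_of_mul_nonneg_right hn (neg_pos.2 h0)
  have hle := sq_ip_one_le (X.2 2)
  rw [phi_apply]
  have : |2 * ip 1 (X.2 2)| ≤ X.1 1 - X.1 0 := by
    refine abs_le_of_sq_le_sq ?_ (by linarith)
    nlinarith [sq_nonneg (X.1 1 + X.1 0)]
  linarith [neg_abs_le (2 * ip 1 (X.2 2))]

/-- This is the equality case of both inequalities behind `phi_nonneg`: it forces ξ₂ = -ξ₁ and x₃ =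
ξ₁ • 1. Then ξ₃ = 0, which kills x₁ and x₂. -/
theorem eq_smul_sigmaPMinus {X : J} (hX : X ∈ nullCone) (hφ : phi X = 0) :
    X = (-X.1 0) • sigmaPMinus := by
  obtain ⟨ht, h₀, h₁, h₂, -⟩ := norms_of_jordan_self (jordan_self_of_mem_nullCone hX)
  have hle := sq_ip_one_le (X.2 2)
  rw [phi_apply] at hφ
  rw [tr] at ht
  have hs : (X.1 1 + X.1 0) ^ 2 = 0 := by
    have : ip 1 (X.2 2) = -(X.1 1 - X.1 0) / 2 := by linarith
    rw [this, h₂] at hle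
    nlinarith [sq_nonneg (X.1 1 + X.1 0)]
  have hy : X.1 1 = -X.1 0 := by
    have := pow_eq_zero_iff two_ne_zero |>.1 hs
    linarith
  have hz : X.1 2 = 0 := by linarith
  have hx : X.2 2 = X.1 0 • (1 : Octonion) := by
    rw [← sub_eq_zero, ← ip_self_eq_zero]
    simp only [ip_sub_left, ip_sub_right, ip_smul_left, ip_smul_right, ip_one_one, ip_comm _ 1, h₂,
      hy, show ip 1 (X.2 2) = X.1 0 by linarith]
    ring
  rw [hz, mul_zero, ip_self_eq_zero] at h₀ h₁
  rw [sigmaPMinus_eq]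
  apply J_ext <;> simp [h1, *]

/-- When `phi > 0`, the null cone equations can be solved successively: `ξ₃ phi = |w|²` gives ξ₃,
the next equation gives the real part of x₃, then come ξ₁, ξ₂ and x₃. Finally a linear equation
gives x₂, and `w` gives x₁. -/
theorem eq_of_mem_nullCone {X Y : J} (hX : X ∈ nullCone) (hY : Y ∈ nullCone) (hp : 0 < phi X)
    (hφ : phi X = phi Y) (hw : X.2 0 + conj (X.2 1) = Y.2 0 + conj (Y.2 1))
    (hU : X.2 2 - conj (X.2 2) = Y.2 2 - conj (Y.2 2)) : X = Y := by
  have key {Z : J} (hZ : Z ∈ nullCone) :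
      Z.1 2 * phi Z = ip (Z.2 0 + conj (Z.2 1)) (Z.2 0 + conj (Z.2 1)) ∧
      4 * phi Z * ip 1 (Z.2 2) = phi Z ^ 2 - Z.1 2 ^ 2 -
        ip (Z.2 2 - conj (Z.2 2)) (Z.2 2 - conj (Z.2 2)) ∧
      Z.1 0 = (2 * ip 1 (Z.2 2) - Z.1 2 - phi Z) / 2 ∧
      Z.1 1 = (phi Z - 2 * ip 1 (Z.2 2) - Z.1 2) / 2 ∧
      (2 : ℝ) • Z.2 2 = (2 * ip 1 (Z.2 2)) • 1 + (Z.2 2 - conj (Z.2 2)) ∧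
      (conj (Z.2 2) - Z.1 0 • 1) * conj (Z.2 1) = -Z.1 0 • (Z.2 0 + conj (Z.2 1)) := by
    obtain ⟨ht, h₀, h₁, h₂, h₃⟩ := norms_of_jordan_self (jordan_self_of_mem_nullCone hZ)
    have h0 : Z.1 0 < 0 := by simpa [ipJ_E₁] using hZ.2.2
    rw [tr] at ht
    -- Multiplying by -ξ₁ ≠ 0 turns x₁ into `conj (x₂ x₃)`, and (x₂ x₃|x₂) = |x₂|² (1|x₃).
    have hi : ip (Z.2 0) (conj (Z.2 1)) = Z.1 2 * ip 1 (Z.2 2) := by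
      refine mul_left_cancel₀ (neg_ne_zero.2 h0.ne) ?_
      rw [← ip_smul_left, h₃, ip_conj_conj, ip_mul_self, h₁, mul_assoc]
    have hq : ip (Z.2 2 - conj (Z.2 2)) (Z.2 2 - conj (Z.2 2)) =
        4 * ip (Z.2 2) (Z.2 2) - 4 * ip 1 (Z.2 2) ^ 2 := by
      have e : conj (Z.2 2) = (2 * ip 1 (Z.2 2)) • 1 - Z.2 2 := by rw [← add_conj]; abel
      rw [e]
      simp only [ip_sub_left, ip_sub_right, ip_smul_left, ip_smul_right, ip_one_one, ip_comm _ 1]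
      ring
    have hx : Z.1 0 = -(Z.1 1 + Z.1 2) := by linarith
    refine ⟨?_, ?_, ?_, ?_, ?_, ?_⟩
    · simp only [ip_add_left, ip_add_right, ip_conj_conj, ip_comm (conj (Z.2 1)), hi, h₀, h₁,
        phi_apply]
      ring
    · rw [hq, h₂, phi_apply, hx]
      ring
    · rw [phi_apply]; linarith
    · rw [phi_apply]; linarith
    · rw [← add_conj]
      module
    · rw [smul_add, h₃, Octonion.conj_mul, sub_mul, smul_mul_assoc, Octonion.one_mul]
      module
  obtain ⟨a₁, a₂, a₃, a₄, a₅, a₆⟩ := key hX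
  obtain ⟨b₁, b₂, b₃, b₄, b₅, b₆⟩ := key hY
  have h2 : X.1 2 = Y.1 2 := by
    refine mul_right_cancel₀ hp.ne' ?_
    rw [a₁, hw, ← b₁, hφ]
  have ht : ip 1 (X.2 2) = ip 1 (Y.2 2) := by
    refine mul_left_cancel₀ (mul_ne_zero four_ne_zero hp.ne') ?_
    rw [a₂, hU, h2, hφ, ← b₂]
  have h0 : X.1 0 = Y.1 0 := by rw [a₃, b₃, ht, h2, hφ]
  have h1' : X.1 1 = Y.1 1 := by rw [a₄, b₄, ht, h2, hφ]
  have k2 : X.2 2 = Y.2 2 := by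
    refine smul_right_injective _ (two_ne_zero (α := ℝ)) ?_
    change (2 : ℝ) • _ = (2 : ℝ) • _
    rw [a₅, b₅, ht, hU]
  -- This is the coefficient of `conj x₂` in the linear equation. Its vanishing would give x₃ = ξ₁ •
  -- 1 and ξ₂ = -ξ₁, hence `phi X = 0`.
  have hne : conj (X.2 2) - X.1 0 • (1 : Octonion) ≠ 0 := by
    intro h
    have e := congrArg (ip 1) h
    have e' := congrArg (fun z => ip z z) h
    obtain ⟨hs, -, -, h₂, -⟩ := norms_of_jordan_self (jordan_self_of_mem_nullCone hX)
    have hx0 : X.1 0 < 0 := by simpa [ipJ_E₁] using hX.2.2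
    simp only [ip_sub_left, ip_sub_right, ip_smul_left, ip_smul_right, ip_one_one, ip_comm _ 1,
      ip_one_conj, ip_conj_conj, h₂, ip_zero] at e e'
    have e₂ : X.1 0 * (X.1 1 + X.1 0) = 0 := by linear_combination -e' - 2 * X.1 0 * e
    have e₃ := (mul_eq_zero.1 e₂).resolve_left hx0.ne
    rw [phi_apply] at hp
    linarith
  have k1 : X.2 1 = Y.2 1 := by
    rw [← conj_conj (X.2 1), ← conj_conj (Y.2 1)]
    congr 1
    rw [← sub_eq_zero]
    refine (eq_zero_or_eq_zero_of_mul_eq_zero ?_).resolve_left hne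
    rw [mul_sub, a₆, hw, h0, k2, b₆, sub_self]
  rw [k1, add_left_inj] at hw
  exact J_ext h0 h1' h2 hw k1 k2

/-! ### Action of `N⁻` on the null cone, and transitivity on a level set of `phi`. -/

/-- Automorphisms preserve `X ∘ X = 0`, so only the sign of ξ₁ is at stake. If `phi X > 0`, then ξ₁
= 0 would force the image to vanish, and ξ₁ > 0 would put its negative in the null cone with `phi <
0`; both contradict the invariance of `phi`. -/
theorem apply_mem_nullCone {g : G} (hg : g ∈ NMinus) {X : J} (hX : X ∈ nullCone) :
    (g : J ≃ₗ[ℝ] J) X ∈ nullCone := by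
  rcases (phi_nonneg hX).eq_or_lt with hφ | hφ
  · rw [eq_smul_sigmaPMinus hX hφ.symm, map_smul, apply_sigmaPMinus_of_mem_NMinus hg,
      ← eq_smul_sigmaPMinus hX hφ.symm]
    exact hX
  · have hj : jordan ((g : J ≃ₗ[ℝ] J) X) ((g : J ≃ₗ[ℝ] J) X) = 0 := by
      have : ∀ A B, (g : J ≃ₗ[ℝ] J) (jordan A B) = jordan ((g : J ≃ₗ[ℝ] J) A) ((g : J ≃ₗ[ℝ] J) B) :=
        g.2
      rw [← this, jordan_self_of_mem_nullCone hX, map_zero]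
    rw [← phi_apply_of_mem_NMinus hg] at hφ
    generalize (g : J ≃ₗ[ℝ] J) X = Y at *
    rcases lt_trichotomy (Y.1 0) 0 with h | h | h
    · exact mem_nullCone_of_jordan_self hj h
    · rw [eq_zero_of_jordan_self hj h, map_zero] at hφ
      exact absurd hφ (lt_irrefl 0)
    · have hj' : jordan (-Y) (-Y) = 0 := by
        rw [← neg_one_smul ℝ Y, jordan_smul_left, jordan_smul_right, hj, smul_zero, smul_zero]
      have := phi_nonneg (mem_nullCone_of_jordan_self hj' (neg_lt_zero.2 h))
      rw [map_neg] at this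
      linarith

theorem phi_PMinus : phi PMinus = 4 := by
  simp [phi_apply, PMinus, h1, ip_one_one]
  norm_num

theorem phi_sigmaPMinus : phi sigmaPMinus = 0 := by
  simp [phi_apply, sigmaPMinus_eq, h1, ip_one_one, ip_neg_right]
  norm_num

theorem subset_NMinus {g : G} (hg : g ∈ expNMinus) : g ∈ NMinus := Subgroup.subset_closure hg

/-- By `eq_of_mem_nullCone`, only `phi`, `w` and the imaginary part of x₃ need to be matched. On
`P⁻`, the exponential changes the last two only through its first-order term. -/
theorem exists_expNMinus_apply_PMinus {X : J} (hX : X ∈ nullCone) (hφ : phi X = 4) :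
    ∃ g ∈ expNMinus, (g : J ≃ₗ[ℝ] J) PMinus = X := by
  -- Since `phi P⁻ = 4`, the first-order term adds `-4 a` to `w` and `8 p` to `x₃ - conj x₃`; both
  -- coordinates vanish at `P⁻`. This dictates `a` and `p`.
  obtain ⟨a, ha⟩ : ∃ a, a = (-1 / 4 : ℝ) • (X.2 0 + conj (X.2 1)) := ⟨_, rfl⟩
  obtain ⟨p, hpdef⟩ : ∃ p, p = (1 / 8 : ℝ) • (X.2 2 - conj (X.2 2)) := ⟨_, rfl⟩
  have hp : conj p = -p := by
    rw [hpdef, conj_smul, conj_sub, conj_conj]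
    module
  have hD := D₁_add_D₂_mem_nMinus a p
  have hD5 := D_pow_five a hp
  obtain ⟨g, hg⟩ := exists_isExp (f4.add_mem (D₁_mem_rootSpace a).1 (D₂_mem_rootSpace p).1) ⟨5, hD5⟩
  have hφ0 Y := phi_comp_of_mem_nMinus hD Y
  have hw Y := weight_one_D a hp Y
  have hU Y := im_D a hp Y
  have hgN : g ∈ expNMinus := ⟨_, hD, hg⟩
  generalize D₁ a + D₂ p = D at *
  have hsum := (hg PMinus).unique (hasSum_sum_of_ne_finset_zero (s := Finset.range 5) fun i hi => by
    rw [pow_eq_zero_of_le (by simpa using hi) hD5, LinearMap.zero_apply, smul_zero])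
  have hw1 := hw PMinus
  have hw' Y : (D (D Y)).2 0 + conj ((D (D Y)).2 1) = 0 := by rw [hw, hφ0, neg_zero, zero_smul]
  have hU1 := hU PMinus
  have hU2 := hU (D PMinus)
  have hU' Y : (D (D (D Y))).2 2 - conj ((D (D (D Y))).2 2) = 0 := by
    rw [hU, hφ0, hw', mul_zero, zero_smul, zero_mul, conj_zero, mul_zero, sub_zero, add_zero]
  have hP0 : PMinus.2 0 = 0 := rfl
  have hP1 : PMinus.2 1 = 0 := rfl
  have hP2 : PMinus.2 2 = 1 := rfl
  have hPφ := phi_PMinus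
  rw [hPφ] at hw1 hU1
  rw [hw1, hφ0] at hU2
  rw [hP0, hP1, conj_zero, add_zero, conj_zero, zero_mul, mul_zero, sub_zero, add_zero] at hU1
  -- The second-order term vanishes because `w (D P⁻)` is a real multiple of `a`, so its two
  -- contributions are the same multiple of `a * conj a` and cancel.
  replace hU2 : (D (D PMinus)).2 2 - conj ((D (D PMinus)).2 2) = 0 := by
    rw [hU2, smul_mul_assoc, conj_smul, mul_smul_comm, sub_self, mul_zero, zero_smul, add_zero]
  simp only [Finset.sum_range_succ, Finset.sum_range_zero, pow_succ, pow_zero, one_mul,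
    Module.End.mul_apply, Module.End.one_apply, zero_add] at hsum
  have hgmem := apply_mem_nullCone (subset_NMinus hgN) PMinus_mem
  refine ⟨g, hgN, eq_of_mem_nullCone hgmem hX ?_ ?_ ?_ ?_⟩
  · rw [phi_apply_of_mem_NMinus (subset_NMinus hgN), hPφ]
    norm_num
  · rw [phi_apply_of_mem_NMinus (subset_NMinus hgN), hPφ, hφ]
  · have h2 := hw' PMinus
    have h3 := hw' (D PMinus)
    have h4 := hw' (D (D PMinus))
    rw [hsum]
    simp only [Prod.snd_add, Prod.smul_snd, Pi.add_apply, Pi.smul_apply, conj_add, conj_smul,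
      hP0, hP1, conj_zero]
    norm_num [Nat.factorial]
    linear_combination (norm := module) hw1 + (1 / 2 : ℝ) • h2 + (1 / 6 : ℝ) • h3
      + (1 / 24 : ℝ) • h4 - (4 : ℝ) • ha
  · have h3 := hU' PMinus
    have h4 := hU' (D PMinus)
    rw [hsum]
    simp only [Prod.snd_add, Prod.smul_snd, Pi.add_apply, Pi.smul_apply, conj_add, conj_smul,
      hP2, conj_one]
    norm_num [Nat.factorial]
    linear_combination (norm := module) hU1 + (1 / 2 : ℝ) • hU2 + (1 / 6 : ℝ) • h3
      + (1 / 24 : ℝ) • h4 + (8 : ℝ) • hpdef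

/-! ### Passage to rays, and the two orbits. -/

theorem smul_cls {g : G} (hg : g ∈ NMinus) {X : J} (hX : X ∈ nullCone) :
    g • cls X hX = cls ((g : J ≃ₗ[ℝ] J) X) (apply_mem_nullCone hg hX) := rfl

theorem smul_mem_nullCone {X : J} (hX : X ∈ nullCone) {r : ℝ} (hr : 0 < r) :
    r • X ∈ nullCone := by
  refine mem_nullCone_of_jordan_self ?_ ?_
  · rw [jordan_smul_left, jordan_smul_right, jordan_self_of_mem_nullCone hX, smul_zero, smul_zero]
  · have h0 : X.1 0 < 0 := by simpa [ipJ_E₁] using hX.2.2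
    exact mul_neg_of_pos_of_neg hr h0

theorem cls_smul {X : J} (hX : X ∈ nullCone) {r : ℝ} (hr : 0 < r) :
    cls (r • X) (smul_mem_nullCone hX hr) = cls X hX :=
  ray_pos_smul _ hr _

theorem cls_congr {X Y : J} (h : X = Y) (hX : X ∈ nullCone) (hY : Y ∈ nullCone) :
    cls X hX = cls Y hY := by
  subst h
  rfl

theorem cls_eq_sigmaPMinus {X : J} (hX : X ∈ nullCone) (hφ : phi X = 0) :
    cls X hX = cls sigmaPMinus sigmaPMinus_mem := by
  have h0 : X.1 0 < 0 := by simpa [ipJ_E₁] using hX.2.2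
  rw [← cls_smul sigmaPMinus_mem (neg_pos.2 h0)]
  exact cls_congr (eq_smul_sigmaPMinus hX hφ) _ _

/-- A ray with `phi > 0` has a unique representative on the level `phi = 4` of `P⁻`, where a single
exponential reaches it. -/
theorem exists_expNMinus_smul_cls {X : J} (hX : X ∈ nullCone) (hφ : 0 < phi X) :
    ∃ g ∈ expNMinus, cls X hX = g • cls PMinus PMinus_mem := by
  have hr : 0 < 4 / phi X := by positivity
  obtain ⟨g, hg, h⟩ := exists_expNMinus_apply_PMinus (smul_mem_nullCone hX hr) (by
    rw [map_smul, smul_eq_mul, div_mul_cancel₀ _ hφ.ne'])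
  refine ⟨g, hg, ?_⟩
  rw [smul_cls (subset_NMinus hg), ← cls_smul hX hr]
  exact cls_congr h.symm _ _

theorem orbit_sigmaPMinus : MulAction.orbit NMinus (cls sigmaPMinus sigmaPMinus_mem) =
    {cls sigmaPMinus sigmaPMinus_mem} := by
  refine Set.Subset.antisymm ?_ (Set.singleton_subset_iff.2 (MulAction.mem_orbit_self _))
  rintro _ ⟨g, rfl⟩
  exact (smul_cls g.2 _).trans (cls_congr (apply_sigmaPMinus_of_mem_NMinus g.2) _ _)

theorem orbit_PMinus_subset : MulAction.orbit NMinus (cls PMinus PMinus_mem) ⊆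
    {q | ∃ X, ∃ hX : X ∈ nullCone, q = cls X hX ∧ 0 < phi X} := by
  rintro _ ⟨g, rfl⟩
  refine ⟨_, apply_mem_nullCone g.2 PMinus_mem, smul_cls g.2 _, ?_⟩
  rw [phi_apply_of_mem_NMinus g.2, phi_PMinus]
  norm_num

theorem exp_smul_subset_orbit (q : Module.Ray ℝ J) :
    {q' | ∃ n ∈ expNMinus, q' = n • q} ⊆ MulAction.orbit NMinus q := by
  rintro _ ⟨n, hn, rfl⟩
  exact ⟨⟨n, subset_NMinus hn⟩, rfl⟩

theorem one_mem_expNMinus : 1 ∈ expNMinus := by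
  refine ⟨0, zero_mem _, fun X => ?_⟩
  convert hasSum_single 0 ?_ using 1
  · simp
  · rintro (_ | k) hk
    · exact absurd rfl hk
    · simp

theorem orbit_PMinus_eq_pos : MulAction.orbit NMinus (cls PMinus PMinus_mem) =
    {q | ∃ X, ∃ hX : X ∈ nullCone, q = cls X hX ∧ 0 < phi X} := by
  refine orbit_PMinus_subset.antisymm ?_
  rintro _ ⟨X, hX, rfl, hφ⟩
  exact exp_smul_subset_orbit _ (exists_expNMinus_smul_cls hX hφ)

/-- The sign of `phi` is constant along a ray, and `phi σP⁻ = 0`; this makes the orbits disjoint. -/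
theorem not_phi_pos_of_cls_eq {X : J} (hX : X ∈ nullCone)
    (h : cls X hX = cls sigmaPMinus sigmaPMinus_mem) : ¬ 0 < phi X := by
  intro hφ
  obtain ⟨r₁, r₂, h₁, -, h₃⟩ := ((ray_eq_iff _ _).1 h).exists_pos
    (ne_zero_of_mem_nullCone hX) (ne_zero_of_mem_nullCone sigmaPMinus_mem)
  have := congrArg phi h₃
  rw [map_smul, map_smul, phi_sigmaPMinus, smul_eq_mul, smul_zero] at this
  exact (mul_pos h₁ hφ).ne' this

end F4

end

theorem theorem9p9 :
    -- `𝓕` is the disjoint union of the two `N⁻`-orbits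
    F4.F = MulAction.orbit F4.NMinus (F4.cls F4.PMinus F4.PMinus_mem) ∪
        MulAction.orbit F4.NMinus (F4.cls F4.sigmaPMinus F4.sigmaPMinus_mem) ∧
    Disjoint (MulAction.orbit F4.NMinus (F4.cls F4.PMinus F4.PMinus_mem))
        (MulAction.orbit F4.NMinus (F4.cls F4.sigmaPMinus F4.sigmaPMinus_mem)) ∧
    -- the orbit of `[P⁻]`
    MulAction.orbit F4.NMinus (F4.cls F4.PMinus F4.PMinus_mem) =
      {q | ∃ X, ∃ hX : X ∈ F4.nullCone, q = F4.cls X hX ∧ 0 < F4.ipJ X F4.sigmaPMinus} ∧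
    MulAction.orbit F4.NMinus (F4.cls F4.PMinus F4.PMinus_mem) =
      {q | ∃ X, ∃ hX : X ∈ F4.nullCone, q = F4.cls X hX ∧ F4.ipJ X F4.sigmaPMinus ≠ 0} ∧
    -- the orbit of `[σP⁻]`
    MulAction.orbit F4.NMinus (F4.cls F4.sigmaPMinus F4.sigmaPMinus_mem) =
      {q | ∃ X, ∃ hX : X ∈ F4.nullCone, q = F4.cls X hX ∧ F4.ipJ X F4.sigmaPMinus = 0} ∧
    MulAction.orbit F4.NMinus (F4.cls F4.sigmaPMinus F4.sigmaPMinus_mem) =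
      {F4.cls F4.sigmaPMinus F4.sigmaPMinus_mem} ∧
    -- both orbits are already swept out by the elements `exp D` with `D ∈ 𝔫⁻`
    MulAction.orbit F4.NMinus (F4.cls F4.PMinus F4.PMinus_mem) =
      {q | ∃ n ∈ F4.expNMinus, q = n • F4.cls F4.PMinus F4.PMinus_mem} ∧
    MulAction.orbit F4.NMinus (F4.cls F4.sigmaPMinus F4.sigmaPMinus_mem) =
      {q | ∃ n ∈ F4.expNMinus, q = n • F4.cls F4.sigmaPMinus F4.sigmaPMinus_mem} := by
  simp only [F4.ipJ_sigmaPMinus]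
  refine ⟨?_, ?_, F4.orbit_PMinus_eq_pos, ?_, ?_, F4.orbit_sigmaPMinus, ?_, ?_⟩
  · rw [F4.orbit_PMinus_eq_pos, F4.orbit_sigmaPMinus]
    refine Set.Subset.antisymm ?_ ?_
    · rintro _ ⟨X, hX, rfl⟩
      rcases (F4.phi_nonneg hX).eq_or_lt with hφ | hφ
      · exact Or.inr (F4.cls_eq_sigmaPMinus hX hφ.symm)
      · exact Or.inl ⟨X, hX, rfl, hφ⟩
    · rintro _ (⟨X, hX, rfl, -⟩ | rfl)
      · exact ⟨X, hX, rfl⟩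
      · exact ⟨_, F4.sigmaPMinus_mem, rfl⟩
  · rw [F4.orbit_PMinus_eq_pos, F4.orbit_sigmaPMinus, Set.disjoint_singleton_right]
    rintro ⟨X, hX, h, hφ⟩
    exact F4.not_phi_pos_of_cls_eq hX h.symm hφ
  · rw [F4.orbit_PMinus_eq_pos]
    ext q
    constructor
    · rintro ⟨X, hX, h, hφ⟩
      exact ⟨X, hX, h, hφ.ne'⟩
    · rintro ⟨X, hX, h, hφ⟩
      exact ⟨X, hX, h, (F4.phi_nonneg hX).lt_of_ne' hφ⟩
  · rw [F4.orbit_sigmaPMinus]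
    ext q
    constructor
    · rintro rfl
      exact ⟨_, F4.sigmaPMinus_mem, rfl, F4.phi_sigmaPMinus⟩
    · rintro ⟨X, hX, rfl, hφ⟩
      exact F4.cls_eq_sigmaPMinus hX hφ
  · refine Set.Subset.antisymm ?_ (F4.exp_smul_subset_orbit _)
    rw [F4.orbit_PMinus_eq_pos]
    rintro _ ⟨X, hX, rfl, hφ⟩
    exact F4.exists_expNMinus_smul_cls hX hφ
  · refine Set.Subset.antisymm ?_ (F4.exp_smul_subset_orbit _)
    rw [F4.orbit_sigmaPMinus]
    rintro _ rfl
    exact ⟨1, F4.one_mem_expNMinus, (one_smul _ _).symm⟩
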